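/- Let $\mathcal N=\{2\pi\sqrt{(k^2+kl+l^2)/3}:k,l\in\mathbb N,\ k,l\ge 1\}$ be the set of critical lengths, let $L_0\in\mathcal N$ and $0<\delta<L_0/2$, and let $I=[L_0-\delta,L_0+\delta]$ satisfy $I\cap\mathcal N=\{L_0\}$. For $L\in I$ let $\mathcal B=\mathcal B(L)$ be the operator $\mathcal B\varphi=-\varphi'''-\varphi'$ on $L^2((0,L);\mathbb C)$ with domain $$D(\mathcal B)=\{\varphi\in H^3(0,L):\varphi(0)=\varphi(L)=0,\ \varphi'(0)=\varphi'(L)\}.$$ For $\lambda\in\mathbb R$, an eigenvalue $i\lambda$ of $\mathcal B$ is called elliptic if $\lambda=2\tau(4\tau^2-1)$ for some $\tau\in\mathbb R$ with $3\tau^2<1$ and $\tau\ne\pm\frac{\sqrt3}{6}$ (equivalently, $|\lambda|<\frac{2\sqrt3}{9}$). Let $K>\frac{2\sqrt3}{9}$. Then there is a constant $\gamma=\gamma(K)>0$ (depending also on the interval $I$, but not on $L$) such that for every $L\in I$, every $\lambda\in\mathbb R$ with $|\lambda|\le K$ for which $i\lambda$ is a non-elliptic eigenvalue of $\mathcal B(L)$,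 and every eigenfunction $\mathscr E$ of $\mathcal B(L)$ for the eigenvalue $i\lambda$ with $\|\mathscr E\|_{L^2(0,L)}=1$, $$|\mathscr E'(0)|=|\mathscr E'(L)|\ge\gamma .$$ -/

import Mathlib

open MeasureTheory Set
open scoped ContDiff ENNReal

namespace KdV

/-- The set of critical lengths `2π √((k² + kl + l²)/3)`, `k, l` positive integers. -/
def criticalLengths : Set ℝ :=
  {L | ∃ k l : ℕ, 0 < k ∧ 0 < l ∧
    L = 2 * Real.pi * Real.sqrt (((k : ℝ) ^ 2 + k * l + (l : ℝ) ^ 2) / 3)}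

/-- `Icc (L₀ - δ) (L₀ + δ)` is an admissible interval around the critical length `L₀`: its radius
is less than `L₀ / 2`, and it contains no other critical length. -/
structure IsAdmissible (L₀ δ : ℝ) : Prop where
  critical : L₀ ∈ criticalLengths
  radius_pos : 0 < δ
  radius_lt : δ < L₀ / 2
  inter_eq : Icc (L₀ - δ) (L₀ + δ) ∩ criticalLengths = {L₀}

/-- `f ∈ L²((0, L); ℂ)`. -/
def MemL2 (L : ℝ) (f : ℝ → ℂ) : Prop :=
  MemLp f 2 (volume.restrict (Ioo 0 L))

/-- `g` is a weak derivative of order `m` of `f` on the open interval `(0, L)`: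
`∫ η⁽ᵐ⁾ f = (-1)ᵐ ∫ η g` for all smooth `η` with compact support in `(0, L)`.
(Used below only for square integrable `f` and `g`.) -/
def IsWeakDeriv (L : ℝ) (m : ℕ) (f g : ℝ → ℂ) : Prop :=
  ∀ η : ℝ → ℝ, ContDiff ℝ ∞ η → HasCompactSupport η → tsupport η ⊆ Ioo 0 L →
    ∫ x in Ioo 0 L, iteratedDeriv m η x • f x = (-1) ^ m * ∫ x in Ioo 0 L, η x • g x

/-- `f` belongs to the Sobolev space `Hⁿ((0, L); ℂ)`: `f` and its weak derivatives of
order up to `n` are square integrable. -/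
def MemH (L : ℝ) (n : ℕ) (f : ℝ → ℂ) : Prop :=
  MemL2 L f ∧ ∀ m ≤ n, ∃ g : ℝ → ℂ, MemL2 L g ∧ IsWeakDeriv L m f g

/-- The domain of `𝓑` on `(0, L)`:
`φ ∈ H³(0, L)` with `φ(0) = φ(L) = 0` and `φ'(0) = φ'(L)`. As is usual, an element of `H³(0, L)`
is identified with its unique representative that is continuously differentiable on `[0, L]`;
the boundary values are those of this representative. -/
structure MemDomB (L : ℝ) (φ : ℝ → ℂ) : Prop where
  memH : MemH L 3 φ
  contDiffOn : ContDiffOn ℝ 1 φ (Icc 0 L)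
  left : φ 0 = 0
  right : φ L = 0
  deriv_eq : derivWithin φ (Icc 0 L) 0 = derivWithin φ (Icc 0 L) L

/-- `φ` is in the domain of `𝓑` and `𝓑 φ = -φ''' - φ' = ψ` in `L²(0, L)`. -/
def IsImageB (L : ℝ) (φ ψ : ℝ → ℂ) : Prop :=
  MemDomB L φ ∧ ∃ φ₁ φ₃ : ℝ → ℂ,
    MemL2 L φ₁ ∧ IsWeakDeriv L 1 φ φ₁ ∧ MemL2 L φ₃ ∧ IsWeakDeriv L 3 φ φ₃ ∧
    ψ =ᵐ[volume.restrict (Ioo 0 L)] fun x => -φ₃ x - φ₁ x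

/-- `E` is an eigenfunction of `𝓑` on `(0, L)` for the eigenvalue `i lam`, normalized by
`‖E‖_{L²(0, L)} = 1` (in particular it is not zero). -/
def IsNormalizedEigenfunctionB (L lam : ℝ) (E : ℝ → ℂ) : Prop :=
  IsImageB L E (fun x => Complex.I * (lam : ℂ) * E x) ∧
    eLpNorm E 2 (volume.restrict (Ioo 0 L)) = 1

/-- `i lam` lies in the elliptic regime: `lam = 2τ(4τ² - 1)` for a real `τ` with `3τ² - 1 < 0`.
The values `τ = ±√3/6`, where two roots of the characteristic equation `ξ³ - ξ - lam = 0`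
coincide and `|lam| = 2√3/9`, are excluded. So the regime is `|lam| < 2√3/9`. -/
def IsElliptic (lam : ℝ) : Prop :=
  ∃ τ : ℝ, lam = 2 * τ * (4 * τ ^ 2 - 1) ∧ 3 * τ ^ 2 - 1 < 0 ∧
    τ ≠ Real.sqrt 3 / 6 ∧ τ ≠ -(Real.sqrt 3 / 6)

end KdV

/-!
Any function in the domain of `𝓑` satisfying `𝓑 E = i lam E` is, by the fundamental lemma of the
calculus of variations for third derivatives, a classical solution of `E''' + E' + i lam E = 0` on
`[0, L]` (`KdV.IsImageB.exists_classical`). It is therefore determined by its Cauchy data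
`(0, E'(0), E''(0))`, through the exponential of a first order system.

The point is that in the non-elliptic regime `E'(0) = E'(L) = 0` forces `E = 0`
(`KdV.IsSolution.eq_zero_of_overdetermined`). If `r, s, t` are the characteristic roots, then
`(D - s)(D - t)E` is a multiple of `exp (r x)`; evaluating at the two ends gives
`E''(L) = E''(0) exp (r L)` for each of the three roots. One root is purely imaginary, and outside
the elliptic regime the other two are not, unless they coincide. In the first case the moduli of
`exp (r L)` differ, and in the second the double root gives `L E''(0) = 0`; so `E''(0) = 0` in
both cases.

This holds for every `L > 0`, critical or not. As the lengths stay in a compact subset of `(0, ∞)`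
and `lam` in a compact set, and the solution depends continuously on `L`, `lam` and the Cauchy data,
the sum `|E(L)| + |E'(L) - E'(0)| + |E'(0)|`, which is `|E'(0)|` for an eigenfunction, is bounded
below by a multiple of the norm of the Cauchy data (`KdV.exists_lower_bound`). That norm in turn
controls the `L²` norm of `E`, which is `1`.
-/

namespace KdV

/-! ### The fundamental lemma of the calculus of variations for higher derivatives -/

/-- `η` is a smooth real function with compact support in `(0, L)`. -/
structure IsTest (L : ℝ) (η : ℝ → ℝ) : Prop where
  contDiff : ContDiff ℝ ∞ η
  compact : HasCompactSupport η
  support : tsupport η ⊆ Ioo 0 L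

namespace IsTest

variable {L : ℝ} {η ζ : ℝ → ℝ}

lemma deriv (h : IsTest L η) : IsTest L (deriv η) where
  contDiff := (contDiff_infty_iff_deriv.1 h.contDiff).2
  compact := h.compact.deriv
  support := tsupport_deriv_subset.trans h.support

lemma iteratedDeriv (h : IsTest L η) (n : ℕ) : IsTest L (iteratedDeriv n η) := by
  induction n with
  | zero => simpa using h
  | succ n ih => rw [iteratedDeriv_succ]; exact ih.deriv

lemma eq_zero (h : IsTest L η) {x : ℝ} (hx : x ∉ Ioo 0 L) : η x = 0 :=
  image_eq_zero_of_notMem_tsupport fun hx' => hx (h.support hx')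

lemma sub_smul (h : IsTest L η) (h' : IsTest L ζ) (c : ℝ) :
    IsTest L (fun x => η x - c • ζ x) where
  contDiff := by
    have := h.contDiff
    have := h'.contDiff
    fun_prop
  compact := h.compact.sub (h'.compact.smul_left (f := fun _ => c))
  support := by
    refine (tsupport_sub _ _).trans (union_subset h.support ?_)
    exact (tsupport_smul_subset_right (fun _ => c) ζ).trans h'.support

lemma hasDerivAt (h : IsTest L η) (x : ℝ) : HasDerivAt η (_root_.deriv η x) x :=
  ((contDiff_infty_iff_deriv.1 h.contDiff).1 x).hasDerivAt

lemma integrable_smul (h : IsTest L η) {u : ℝ → ℂ} (hu : Continuous u) :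
    Integrable (fun x => η x • u x) :=
  (h.contDiff.continuous.smul hu).integrable_of_hasCompactSupport h.compact.smul_right

lemma setIntegral_smul (h : IsTest L η) (u : ℝ → ℂ) :
    ∫ x in Ioo 0 L, η x • u x = ∫ x, η x • u x :=
  setIntegral_eq_integral_of_forall_compl_eq_zero fun x hx => by simp [h.eq_zero hx]

lemma integral_deriv_smul (h : IsTest L η) {u u' : ℝ → ℂ} (hu : ∀ x, HasDerivAt u (u' x) x)
    (hu' : Continuous u') : ∫ x, _root_.deriv η x • u x = -∫ x, η x • u' x := by
  have hc : Continuous u := continuous_iff_continuousAt.2 fun x => (hu x).continuousAt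
  have key := integral_eq_zero_of_hasDerivAt_of_integrable
    (fun x => (h.hasDerivAt x).smul (hu x))
    ((h.integrable_smul hu').add (h.deriv.integrable_smul hc)) (h.integrable_smul hc)
  have := integral_add (h.integrable_smul hu') (h.deriv.integrable_smul hc)
  rw [key] at this
  linear_combination -this

/-- Repeated integration by parts against a function `J n` whose successive derivatives are
`J (n - 1), …, J 0`. -/
lemma integral_iteratedDeriv_smul (h : IsTest L η) {J : ℕ → ℝ → ℂ} (h0 : Continuous (J 0))
    (hJ : ∀ k x, HasDerivAt (J (k + 1)) (J k x) x) (n : ℕ) :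
    ∫ x, _root_.iteratedDeriv n η x • J n x = (-1) ^ n * ∫ x, η x • J 0 x := by
  have hc : ∀ k, Continuous (J k)
    | 0 => h0
    | k + 1 => continuous_iff_continuousAt.2 fun x => (hJ k x).continuousAt
  induction n with
  | zero => simp
  | succ n ih =>
    rw [iteratedDeriv_succ, (h.iteratedDeriv n).integral_deriv_smul (hJ n) (hc n), ih]
    ring

/-- A test function with vanishing integral is the derivative of a test function. -/
lemma exists_primitive (h : IsTest L η) (h0 : ∫ x, η x = 0) :
    ∃ ζ, IsTest L ζ ∧ _root_.deriv ζ = η := by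
  obtain ⟨c, d, hc, hd, hcd⟩ : ∃ c d, 0 < c ∧ d < L ∧ tsupport η ⊆ Icc c d := by
    rcases (tsupport η).eq_empty_or_nonempty with he | hne
    · exact ⟨1, L - 1, by simp, by simp, by simp [he]⟩
    · obtain ⟨c, hc, hc'⟩ := h.compact.exists_isLeast hne
      obtain ⟨d, hd, hd'⟩ := h.compact.exists_isGreatest hne
      exact ⟨c, d, (h.support hc).1, (h.support hd).2, fun x hx => ⟨hc' hx, hd' hx⟩⟩
  have hz : ∀ x, x ∉ Icc c d → η x = 0 := fun x hx =>
    image_eq_zero_of_notMem_tsupport fun hx' => hx (hcd hx')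
  have hderiv : ∀ x, HasDerivAt (fun x => ∫ t in (0 : ℝ)..x, η t) (η x) x := fun x =>
    (h.contDiff.continuous.integral_hasStrictDerivAt 0 x).hasDerivAt
  have hd' : _root_.deriv (fun x => ∫ t in (0 : ℝ)..x, η t) = η := funext fun x => (hderiv x).deriv
  have hsupp : tsupport (fun x => ∫ t in (0 : ℝ)..x, η t) ⊆ Icc c d := by
    refine closure_minimal (fun x hx => ?_) isClosed_Icc
    by_contra hx'
    refine hx ?_
    rcases not_and_or.1 hx' with hxc | hxd
    · refine intervalIntegral.integral_zero_ae (.of_forall fun t ht => hz t fun ht' => ?_)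
      rcases mem_uIoc.1 ht with ⟨_, h2⟩ | ⟨_, h2⟩
      · linarith [ht'.1]
      · linarith [ht'.1]
    · -- beyond the support of `η`, the primitive equals the full integral
      have hI : Integrable η := h.contDiff.continuous.integrable_of_hasCompactSupport h.compact
      push Not at hxd
      rcases le_total 0 x with hx0 | hx0
      · beta_reduce
        rw [intervalIntegral.integral_of_le hx0,
          setIntegral_eq_integral_of_forall_compl_eq_zero, h0]
        intro t ht
        refine hz t fun ht' => ht ⟨by linarith [ht'.1], by linarith [ht'.2]⟩
      · refine intervalIntegral.integral_zero_ae (.of_forall fun t ht => hz t fun ht' => ?_)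
        linarith [ht'.1, ht'.2]
  refine ⟨fun x => ∫ t in (0 : ℝ)..x, η t, ⟨?_, ?_, ?_⟩, hd'⟩
  · exact contDiff_infty_iff_deriv.2 ⟨fun x => (hderiv x).differentiableAt, by
      rw [hd']; exact h.contDiff⟩
  · exact isCompact_Icc.of_isClosed_subset (isClosed_tsupport _) hsupp
  · exact hsupp.trans (Icc_subset_Ioo hc hd)

lemma exists_integral_eq_one (hL : 0 < L) : ∃ η, IsTest L η ∧ ∫ x, η x = 1 := by
  let f : ContDiffBump (L / 2) := ⟨L / 8, L / 4, by positivity, by linarith⟩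
  refine ⟨f.normed volume, ⟨f.contDiff_normed, f.hasCompactSupport_normed, ?_⟩, f.integral_normed⟩
  rw [f.tsupport_normed_eq, Real.closedBall_eq_Icc]
  exact Icc_subset_Ioo (by show 0 < L / 2 - L / 4; linarith) (by show L / 2 + L / 4 < L; linarith)

end IsTest

/-- A continuous function whose `n`-th weak derivative on `(0, L)` vanishes is a polynomial of
degree less than `n` there. -/
lemma exists_polynomial_of_weakDeriv_eq_zero {L : ℝ} (hL : 0 < L) (n : ℕ) (u : ℝ → ℂ)
    (hu : Continuous u) (h : ∀ η, IsTest L η → ∫ x, iteratedDeriv n η x • u x = 0) :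
    ∃ P : Polynomial ℂ, P.degree < n ∧ ∀ x ∈ Ioo 0 L, u x = P.eval (x : ℂ) := by
  induction n generalizing u with
  | zero =>
    refine ⟨0, by simp, ?_⟩
    have hae := isOpen_Ioo.ae_eq_zero_of_integral_contDiff_smul_eq_zero (U := Ioo 0 L)
      (μ := volume) (hu.locallyIntegrable.locallyIntegrableOn _)
      (fun η h1 h2 h3 => by simpa using h η ⟨h1, h2, h3⟩)
    have := Measure.eqOn_open_of_ae_eq (f := u) (g := fun _ => 0)
      ((ae_restrict_iff' measurableSet_Ioo).2 hae) isOpen_Ioo hu.continuousOn continuousOn_const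
    simpa using fun x => @this x
  | succ n ih =>
    obtain ⟨η₀, hη₀, h1⟩ := IsTest.exists_integral_eq_one hL
    set c : ℂ := ∫ x, iteratedDeriv n η₀ x • u x with hc
    -- since `η - (∫ η) η₀` is a derivative, the `n`-th weak derivative of `u` is the constant `c`
    have hconst : ∀ η, IsTest L η → ∫ x, iteratedDeriv n η x • u x = c * ∫ x, η x • (1 : ℂ) := by
      intro η hη
      obtain ⟨ζ, hζ, hζ'⟩ := (hη.sub_smul hη₀ (∫ x, η x)).exists_primitive (by
        rw [integral_sub (hη.contDiff.continuous.integrable_of_hasCompactSupport hη.compact)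
          ((hη₀.contDiff.continuous.integrable_of_hasCompactSupport hη₀.compact).fun_smul _),
          integral_smul, h1]
        simp)
      have h0 := h ζ hζ
      rw [iteratedDeriv_succ', hζ'] at h0
      have hd : ∀ x, iteratedDeriv n (fun x => η x - (∫ x, η x) • η₀ x) x • u x =
          iteratedDeriv n η x • u x - (∫ x, η x) • (iteratedDeriv n η₀ x • u x) := by
        intro x
        have a1 : ContDiff ℝ n η := hη.contDiff.of_le (mod_cast le_top)
        have a2 : ContDiff ℝ n η₀ := hη₀.contDiff.of_le (mod_cast le_top)
        rw [iteratedDeriv_fun_sub a1.contDiffAt (contDiff_const.fun_smul a2).contDiffAt,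
          iteratedDeriv_fun_const_smul a2.contDiffAt, sub_smul, smul_assoc]
      simp_rw [hd] at h0
      rw [integral_sub ((hη.iteratedDeriv n).integrable_smul hu)
        (((hη₀.iteratedDeriv n).integrable_smul hu).fun_smul _), integral_smul, ← hc, sub_eq_zero] at h0
      rw [h0, integral_smul_const]
      simp [mul_comm]
    let J : ℕ → ℝ → ℂ := fun k x => (x : ℂ) ^ k / k.factorial
    have hJ : ∀ k x, HasDerivAt (J (k + 1)) (J k x) x := by
      intro k x
      have := ((hasDerivAt_pow (k + 1) (x : ℂ)).comp_ofReal).div_const ((k + 1).factorial : ℂ)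
      refine this.congr_deriv ?_
      have : (k.factorial : ℂ) ≠ 0 := by exact_mod_cast k.factorial_ne_zero
      have : (k + 1 : ℂ) ≠ 0 := by exact_mod_cast k.succ_ne_zero
      simp only [J, Nat.factorial_succ, Nat.add_sub_cancel]
      push_cast
      field_simp
    have hJc : Continuous (J n) := by fun_prop
    obtain ⟨Q, hQ, hQ'⟩ := ih (fun x => u x - ((-1) ^ n * c) • J n x)
      (by fun_prop) (fun η hη => by
        have e : ∀ x, iteratedDeriv n η x • (u x - ((-1) ^ n * c) • J n x) =
            iteratedDeriv n η x • u x - ((-1) ^ n * c) • (iteratedDeriv n η x • J n x) := by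
          intro x
          rw [smul_sub, smul_comm]
        simp_rw [e]
        rw [integral_sub ((hη.iteratedDeriv n).integrable_smul hu)
          (((hη.iteratedDeriv n).integrable_smul hJc).fun_smul _), integral_smul, hconst η hη,
          hη.integral_iteratedDeriv_smul (by fun_prop) hJ n]
        have : ((-1 : ℂ) ^ n) * (-1) ^ n = 1 := by rw [← mul_pow]; simp
        simp only [J, pow_zero, Nat.factorial_zero, Nat.cast_one, div_one, smul_eq_mul]
        linear_combination -(c * ∫ x, η x • (1 : ℂ)) * this)
    refine ⟨Q + Polynomial.C ((-1) ^ n * c / n.factorial) * Polynomial.X ^ n, ?_, fun x hx => ?_⟩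
    · refine (Polynomial.degree_add_le _ _).trans_lt (max_lt (hQ.trans ?_) ?_)
      · exact_mod_cast n.lt_succ_self
      · refine (Polynomial.degree_C_mul_X_pow_le _ _).trans_lt ?_
        exact_mod_cast n.lt_succ_self
    · have := hQ' x hx
      simp only [J, smul_eq_mul] at this
      simp only [Polynomial.eval_add, Polynomial.eval_mul, Polynomial.eval_C, Polynomial.eval_pow,
        Polynomial.eval_X]
      linear_combination this

/-! ### Eigenfunctions are classical solutions -/

/-- The `k`-fold primitive of `u` vanishing to order `k` at `0`. -/
noncomputable def primitive (u : ℝ → ℂ) : ℕ → ℝ → ℂ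
  | 0 => u
  | k + 1 => fun x => ∫ t in (0 : ℝ)..x, primitive u k t

lemma continuous_primitive {u : ℝ → ℂ} (hu : Continuous u) : ∀ k, Continuous (primitive u k)
  | 0 => hu
  | k + 1 => continuous_iff_continuousAt.2 fun x =>
      ((continuous_primitive hu k).integral_hasStrictDerivAt 0 x).hasDerivAt.continuousAt

lemma hasDerivAt_primitive {u : ℝ → ℂ} (hu : Continuous u) (k : ℕ) (x : ℝ) :
    HasDerivAt (primitive u (k + 1)) (primitive u k x) x :=
  ((continuous_primitive hu k).integral_hasStrictDerivAt 0 x).hasDerivAt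

lemma MemL2.integrable_smul {L : ℝ} {f : ℝ → ℂ} (hf : MemL2 L f) {η : ℝ → ℝ} (hη : IsTest L η) :
    Integrable (fun x => η x • f x) (volume.restrict (Ioo 0 L)) := by
  obtain ⟨C, hC⟩ := hη.compact.exists_bound_of_continuous hη.contDiff.continuous
  exact (hf.integrable (by norm_num)).bdd_smul C
    hη.contDiff.continuous.aestronglyMeasurable (.of_forall hC)

/-- The eigenvalue equation `E''' + E' + i lam E = 0`, tested against `η`, for any function `u`
that agrees with `E` on `(0, L)`. -/
lemma IsImageB.weak_equation {L lam : ℝ} {E u : ℝ → ℂ}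
    (h : IsImageB L E (fun x => Complex.I * (lam : ℂ) * E x)) (hu : EqOn u E (Ioo 0 L))
    {η : ℝ → ℝ} (hη : IsTest L η) :
    (∫ x, iteratedDeriv 3 η x • u x) + (∫ x, deriv η x • u x)
      - Complex.I * lam * ∫ x, η x • u x = 0 := by
  obtain ⟨-, φ₁, φ₃, h1, w1, h3, w3, he⟩ := h
  have e1 := w1 η hη.contDiff hη.compact hη.support
  have e3 := w3 η hη.contDiff hη.compact hη.support
  have hcongr : ∀ {ζ : ℝ → ℝ}, IsTest L ζ → ∫ x in Ioo 0 L, ζ x • E x = ∫ x, ζ x • u x := by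
    intro ζ hζ
    rw [← hζ.setIntegral_smul]
    exact setIntegral_congr_fun measurableSet_Ioo fun x hx => by simp [hu hx]
  rw [iteratedDeriv_one, hcongr hη.deriv] at e1
  rw [hcongr (hη.iteratedDeriv 3)] at e3
  have e0 : Complex.I * lam * ∫ x, η x • u x =
      -(∫ x in Ioo 0 L, η x • φ₃ x) - ∫ x in Ioo 0 L, η x • φ₁ x := by
    rw [← hcongr hη, ← integral_const_mul, ← integral_neg,
      ← integral_sub (h3.integrable_smul hη).fun_neg (h1.integrable_smul hη)]
    refine integral_congr_ae (he.mono fun x hx => ?_)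
    simp only [Complex.real_smul] at hx ⊢
    linear_combination (η x : ℂ) * hx
  rw [e0, e1, e3]
  ring

/-- The functions `e₀, e₁, e₂` are a solution of `E''' + E' + i lam E = 0` on `[0, L]` and its first
two derivatives. -/
def IsSolution (L lam : ℝ) (e₀ e₁ e₂ : ℝ → ℂ) : Prop :=
  ∀ x ∈ Icc 0 L, HasDerivAt e₀ (e₁ x) x ∧ HasDerivAt e₁ (e₂ x) x ∧
    HasDerivAt e₂ (-e₁ x - Complex.I * lam * e₀ x) x

/-- An eigenfunction is a classical solution, up to the boundary, of `E''' + E' + i lam E = 0`. -/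
lemma IsImageB.exists_classical {L lam : ℝ} (hL : 0 < L) {E : ℝ → ℂ}
    (h : IsImageB L E (fun x => Complex.I * (lam : ℂ) * E x)) :
    ∃ e₀ e₁ e₂ : ℝ → ℂ, EqOn e₀ E (Icc 0 L) ∧ IsSolution L lam e₀ e₁ e₂ := by
  let u : ℝ → ℂ := IccExtend hL.le (domRestrict (Icc 0 L) E)
  have hu : Continuous u :=
    (continuousOn_iff_continuous_domRestrict.1 h.1.contDiffOn.continuousOn).Icc_extend'
  have huE : EqOn u E (Icc 0 L) := fun x hx => IccExtend_of_mem hL.le _ hx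
  set J := primitive u with hJ
  have hJc := continuous_primitive hu
  have hJd := hasDerivAt_primitive hu
  rw [← hJ] at hJc hJd
  -- integrating the equation three times makes the left-hand side a quadratic polynomial
  obtain ⟨P, hP, hP'⟩ := exists_polynomial_of_weakDeriv_eq_zero hL 3
    (fun x => u x + J 2 x + (Complex.I * lam) * J 3 x)
    ((hu.add (hJc 2)).add (continuous_const.mul (hJc 3))) (fun η hη => by
      have h3 := hη.integral_iteratedDeriv_smul (hJc 0) hJd 3
      have h2 := hη.deriv.integral_iteratedDeriv_smul (hJc 0) hJd 2
      rw [← iteratedDeriv_succ'] at h2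
      have e : ∀ x, iteratedDeriv 3 η x • (u x + J 2 x + (Complex.I * lam) * J 3 x) =
          iteratedDeriv 3 η x • u x + iteratedDeriv 3 η x • J 2 x
            + (Complex.I * lam) * (iteratedDeriv 3 η x • J 3 x) := by
        intro x
        simp only [Complex.real_smul]
        ring
      have hi := fun k => (hη.iteratedDeriv 3).integrable_smul (hJc k)
      have hi0 := (hη.iteratedDeriv 3).integrable_smul hu
      have hw := h.weak_equation (huE.mono Ioo_subset_Icc_self) hη
      simp_rw [e]
      rw [integral_add (hi0.fun_add (hi 2)) ((hi 3).const_mul _), integral_add hi0 (hi 2),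
        integral_const_mul, h3, h2]
      change (∫ x, iteratedDeriv 3 η x • u x) + (-1) ^ 2 * (∫ x, deriv η x • u x) +
        Complex.I * lam * ((-1) ^ 3 * ∫ x, η x • u x) = 0
      linear_combination hw)
  have hPE : ∀ x ∈ Icc 0 L, u x + J 2 x + (Complex.I * lam) * J 3 x = P.eval (x : ℂ) := by
    have := EqOn.closure (s := Ioo 0 L) hP' ((hu.add (hJc 2)).add (continuous_const.mul (hJc 3)))
      (P.continuous.comp Complex.continuous_ofReal)
    rw [closure_Ioo hL.ne] at this
    exact this
  have hd : ∀ (Q : Polynomial ℂ) (x : ℝ),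
      HasDerivAt (fun x : ℝ => Q.eval (x : ℂ)) (Q.derivative.eval (x : ℂ)) x :=
    fun Q x => (Q.hasDerivAt (x : ℂ)).comp_ofReal
  have hP3 : P.derivative.derivative.derivative = 0 := by
    by_cases h0 : P = 0
    · simp [h0]
    · exact Polynomial.iterate_derivative_eq_zero (x := 3)
        ((Polynomial.natDegree_lt_iff_degree_lt h0).2 hP)
  refine ⟨fun x => P.eval (x : ℂ) - J 2 x - Complex.I * lam * J 3 x,
    fun x => P.derivative.eval (x : ℂ) - J 1 x - Complex.I * lam * J 2 x,
    fun x => P.derivative.derivative.eval (x : ℂ)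
      - (P.eval (x : ℂ) - J 2 x - Complex.I * lam * J 3 x) - Complex.I * lam * J 1 x,
    fun x hx => ?_, fun x hx => ⟨?_, ?_, ?_⟩⟩
  · rw [← huE hx]
    linear_combination -hPE x hx
  · exact ((hd P x).sub (hJd 1 x)).sub ((hJd 2 x).const_mul _)
  · refine (((hd _ x).sub (hJd 0 x)).sub ((hJd 1 x).const_mul _)).congr_deriv ?_
    change _ - u x - _ = _
    linear_combination -hPE x hx
  · refine (((hd _ x).sub (((hd P x).sub (hJd 1 x)).sub ((hJd 2 x).const_mul _))).sub
      ((hJd 0 x).const_mul _)).congr_deriv ?_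
    change _ - _ - Complex.I * lam * u x = _
    rw [hP3, Polynomial.eval_zero]
    linear_combination (-Complex.I * lam) * hPE x hx

/-! ### Overdetermined solutions vanish outside the elliptic regime -/

lemma eq_mul_exp_of_hasDerivAt {L : ℝ} {g : ℝ → ℂ} {r : ℂ}
    (h : ∀ x ∈ Icc 0 L, HasDerivAt g (r * g x) x) :
    ∀ x ∈ Icc 0 L, g x = g 0 * Complex.exp (r * x) := by
  intro x hx
  have hexp : ∀ x : ℝ, HasDerivAt (fun x : ℝ => Complex.exp (-r * x))
      (Complex.exp (-r * x) * (-r * 1)) x := fun x =>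
    (((hasDerivAt_id (x : ℂ)).const_mul (-r)).cexp).comp_ofReal
  have hd : ∀ x ∈ Icc 0 L, HasDerivAt (fun x : ℝ => Complex.exp (-r * x) * g x) 0 x :=
    fun x hx => ((hexp x).mul (h x hx)).congr_deriv (by ring)
  have := constant_of_has_deriv_right_zero (fun x hx => (hd x hx).continuousAt.continuousWithinAt)
    (fun x hx => (hd x (Ico_subset_Icc_self hx)).hasDerivWithinAt) x hx
  have he : Complex.exp (-r * x) * Complex.exp (r * x) = 1 := by rw [← Complex.exp_add]; simp
  simp only [Complex.ofReal_zero, mul_zero, Complex.exp_zero, one_mul] at this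
  linear_combination (-g x) * he + Complex.exp (r * x) * this

/-- If `r, s, t` are the characteristic roots, then `(D - s)(D - t)E` is a multiple of
`exp (r x)`. -/
lemma IsSolution.factor {L lam : ℝ} {e₀ e₁ e₂ : ℝ → ℂ} (h : IsSolution L lam e₀ e₁ e₂)
    {r s t : ℂ} (h1 : r + s + t = 0) (h2 : r * s + s * t + t * r = 1)
    (h3 : r * s * t = -Complex.I * lam) {x : ℝ} (hx : x ∈ Icc 0 L) :
    e₂ x - (s + t) * e₁ x + s * t * e₀ x =
      (e₂ 0 - (s + t) * e₁ 0 + s * t * e₀ 0) * Complex.exp (r * x) := by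
  refine eq_mul_exp_of_hasDerivAt (g := fun x => e₂ x - (s + t) * e₁ x + s * t * e₀ x)
    (fun x hx => ?_) x hx
  obtain ⟨d0, d1, d2⟩ := h x hx
  refine ((d2.sub (d1.const_mul (s + t))).add (d0.const_mul (s * t))).congr_deriv ?_
  linear_combination (-e₂ x) * h1 + e₁ x * h2 - e₀ x * h3

/-- For `lam = ξ³ - ξ` with `3ξ² ≥ 4`, the characteristic roots are `iξ` and `-iξ/2 ± q` with `q`
real. A solution vanishing to second order at both ends forces `exp (r L)` to take the same value at
all three roots `r`, hence `q = 0`, and then the double root gives a further condition. -/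
lemma IsSolution.eq_zero_of_overdetermined {L ξ : ℝ} (hL : 0 < L) (hξ : 4 ≤ 3 * ξ ^ 2)
    {e₀ e₁ e₂ : ℝ → ℂ} (h : IsSolution L (ξ ^ 3 - ξ) e₀ e₁ e₂)
    (h00 : e₀ 0 = 0) (h0L : e₀ L = 0) (h10 : e₁ 0 = 0) (h1L : e₁ L = 0) : e₂ 0 = 0 := by
  by_contra hb
  set q : ℝ := Real.sqrt (3 * ξ ^ 2 - 4) / 2 with hq
  have hq2 : 4 * (q : ℂ) ^ 2 = 3 * ξ ^ 2 - 4 := by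
    have : 4 * q ^ 2 = 3 * ξ ^ 2 - 4 := by
      rw [hq, div_pow, Real.sq_sqrt (by linarith)]; ring
    exact_mod_cast this
  have hI := Complex.I_sq
  set r : ℂ := Complex.I * ξ with hr
  set s : ℂ := -(Complex.I * ξ) / 2 + q with hs
  set t : ℂ := -(Complex.I * ξ) / 2 - q with ht
  have v1 : r + s + t = 0 := by rw [hr, hs, ht]; ring
  have v2 : r * s + s * t + t * r = 1 := by
    rw [hr, hs, ht]
    linear_combination (-3 / 4 * (ξ : ℂ) ^ 2) * hI - hq2 / 4
  have v3 : r * s * t = -Complex.I * (ξ ^ 3 - ξ : ℝ) := by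
    rw [hr, hs, ht]
    push_cast
    linear_combination (Complex.I * ξ ^ 3 / 4) * hI - (Complex.I * ξ / 4) * hq2
  have hL' : L ∈ Icc 0 L := right_mem_Icc.2 hL.le
  have fr := h.factor v1 v2 v3 hL'
  have fs := h.factor (r := s) (s := t) (t := r) (by linear_combination v1)
    (by linear_combination v2) (by linear_combination v3) hL'
  simp only [h00, h0L, h10, h1L, mul_zero, sub_zero, add_zero] at fr fs
  have hexp : Complex.exp (r * L) = Complex.exp (s * L) := mul_left_cancel₀ hb (fr.symm.trans fs)
  have hq0 : q = 0 := by
    have hn := congrArg norm hexp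
    rw [Complex.norm_exp, Complex.norm_exp] at hn
    have := Real.exp_injective hn
    simp [hr, hs, hL.ne'] at this
    exact this
  have hst : t = s := by rw [hs, ht, hq0]; simp
  rw [hst] at v1 v2 v3
  -- the derivative of `exp (-s x) (D - r)E` is the constant `E''(0)`
  have hexp' : ∀ x : ℝ, HasDerivAt (fun x : ℝ => Complex.exp (-s * x))
      (Complex.exp (-s * x) * (-s * 1)) x := fun x =>
    (((hasDerivAt_id (x : ℂ)).const_mul (-s)).cexp).comp_ofReal
  have hd : ∀ x ∈ Icc 0 L, HasDerivAt
      (fun x : ℝ => Complex.exp (-s * x) * (e₁ x - r * e₀ x) - e₂ 0 * (x : ℂ)) 0 x := by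
    intro x hx
    obtain ⟨d0, d1, d2⟩ := h x hx
    have f := h.factor (r := s) (s := s) (t := r) (by linear_combination v1)
      (by linear_combination v2) (by linear_combination v3) hx
    have he : Complex.exp (-s * x) * Complex.exp (s * x) = 1 := by rw [← Complex.exp_add]; simp
    refine (((hexp' x).mul (d1.sub (d0.const_mul r))).sub
      (((hasDerivAt_id (x : ℂ)).const_mul (e₂ 0)).comp_ofReal)).congr_deriv ?_
    simp only [h00, h10, mul_zero, sub_zero, add_zero] at f
    simp only [Pi.sub_apply]
    linear_combination Complex.exp (-s * x) * f + e₂ 0 * he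
  have := constant_of_has_deriv_right_zero (fun x hx => (hd x hx).continuousAt.continuousWithinAt)
    (fun x hx => (hd x (Ico_subset_Icc_self hx)).hasDerivWithinAt) L hL'
  simp [h00, h0L, h10, h1L, hb, hL.ne'] at this

/-! ### The first order system -/

/-- The matrix of `E''' + E' + i lam E = 0` as a first order system for `(E, E', E'')`. -/
noncomputable def system (lam : ℝ) : ℂ × ℂ × ℂ →L[ℝ] ℂ × ℂ × ℂ :=
  ((ContinuousLinearMap.fst ℝ ℂ ℂ).comp (ContinuousLinearMap.snd ℝ ℂ (ℂ × ℂ))).prod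
    (((ContinuousLinearMap.snd ℝ ℂ ℂ).comp (ContinuousLinearMap.snd ℝ ℂ (ℂ × ℂ))).prod
      (-(ContinuousLinearMap.fst ℝ ℂ ℂ).comp (ContinuousLinearMap.snd ℝ ℂ (ℂ × ℂ)))) -
  lam • (0 : ℂ × ℂ × ℂ →L[ℝ] ℂ).prod ((0 : ℂ × ℂ × ℂ →L[ℝ] ℂ).prod
    (Complex.I • ContinuousLinearMap.fst ℝ ℂ (ℂ × ℂ)))

lemma system_apply (lam : ℝ) (y : ℂ × ℂ × ℂ) :
    system lam y = (y.2.1, y.2.2, -y.2.1 - Complex.I * lam * y.1) := by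
  simp [system]
  ring

lemma continuous_system : Continuous system :=
  continuous_const.sub (continuous_id.smul continuous_const)

/-- The state `(E, E', E'')` at `x` of the solution with state `y` at `0`. -/
noncomputable def flow (lam x : ℝ) (y : ℂ × ℂ × ℂ) : ℂ × ℂ × ℂ :=
  NormedSpace.exp (x • system lam) y

lemma continuous_exp_system :
    Continuous fun p : ℝ × ℝ => NormedSpace.exp (p.1 • system p.2) := by
  let _ : NormedAlgebra ℚ (ℂ × ℂ × ℂ →L[ℝ] ℂ × ℂ × ℂ) := NormedAlgebra.restrictScalars ℚ ℝ _
  exact NormedSpace.exp_continuous.comp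
    (continuous_fst.smul (continuous_system.comp continuous_snd))

lemma flow_zero (lam : ℝ) (y : ℂ × ℂ × ℂ) : flow lam 0 y = y := by
  have h : (0 : ℝ) • system lam = 0 :=
    ContinuousLinearMap.ext fun z => zero_smul ℝ (system lam z)
  rw [flow, h, NormedSpace.exp_zero]
  rfl

lemma flow_smul (lam x c : ℝ) (y : ℂ × ℂ × ℂ) : flow lam x (c • y) = c • flow lam x y :=
  map_smul _ _ _

lemma hasDerivAt_flow (lam x : ℝ) (y : ℂ × ℂ × ℂ) :
    HasDerivAt (fun x => flow lam x y) (system lam (flow lam x y)) x :=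
  (hasDerivAt_exp_smul_const' (𝕂 := ℝ) (system lam) x).clm_apply (hasDerivAt_const x y)
    |>.congr_deriv (by simp [flow])

lemma isSolution_flow (L lam : ℝ) (y : ℂ × ℂ × ℂ) :
    IsSolution L lam (fun x => (flow lam x y).1) (fun x => (flow lam x y).2.1)
      (fun x => (flow lam x y).2.2) := by
  intro x _
  have h := hasDerivAt_flow lam x y
  rw [system_apply] at h
  exact ⟨h.fst, h.snd.fst, h.snd.snd⟩

lemma IsSolution.eq_flow {L lam : ℝ} {e₀ e₁ e₂ : ℝ → ℂ} (h : IsSolution L lam e₀ e₁ e₂)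
    {x : ℝ} (hx : x ∈ Icc 0 L) :
    (e₀ x, e₁ x, e₂ x) = flow lam x (e₀ 0, e₁ 0, e₂ 0) := by
  have hd : ∀ x ∈ Icc 0 L, HasDerivAt (fun x => (e₀ x, e₁ x, e₂ x))
      (system lam (e₀ x, e₁ x, e₂ x)) x := fun x hx => by
    obtain ⟨d0, d1, d2⟩ := h x hx
    rw [system_apply]
    exact d0.prodMk (d1.prodMk d2)
  refine ODE_solution_unique (v := fun _ => system lam) (fun _ => (system lam).lipschitz)
    (fun x hx => (hd x hx).continuousAt.continuousWithinAt)
    (fun x hx => (hd x (Ico_subset_Icc_self hx)).hasDerivWithinAt)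
    (fun x _ => (hasDerivAt_flow lam x _).continuousAt.continuousWithinAt)
    (fun x _ => (hasDerivAt_flow lam x _).hasDerivWithinAt) ?_ hx
  rw [flow_zero]

/-! ### Compactness -/

/-- By compactness, `eq_zero_of_overdetermined` holds quantitatively, uniformly in the length and
the frequency. -/
lemma exists_lower_bound {a : ℝ} (ha : 0 < a) (b R : ℝ) :
    ∃ m, 0 < m ∧ ∀ L ∈ Icc a b, ∀ ξ : ℝ, 4 ≤ 3 * ξ ^ 2 → |ξ| ≤ R → ∀ v : ℂ × ℂ,
      m * ‖v‖ ≤ ‖(flow (ξ ^ 3 - ξ) L (0, v)).1‖ + ‖(flow (ξ ^ 3 - ξ) L (0, v)).2.1 - v.1‖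
        + ‖v.1‖ := by
  have hS : IsCompact (Icc (-R) R ∩ {ξ : ℝ | 4 ≤ 3 * ξ ^ 2}) :=
    isCompact_Icc.inter_right (isClosed_le continuous_const (by fun_prop))
  have hK := (isCompact_Icc (a := a) (b := b)).prod (hS.prod (isCompact_sphere (0 : ℂ × ℂ) 1))
  have hflow : Continuous fun p : ℝ × ℝ × ℂ × ℂ => flow (p.2.1 ^ 3 - p.2.1) p.1 (0, p.2.2) := by
    have : Continuous fun p : ℝ × ℝ × ℂ × ℂ => (p.1, p.2.1 ^ 3 - p.2.1) := by fun_prop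
    exact (continuous_exp_system.comp this).clm_apply (by fun_prop)
  obtain ⟨m, hm, hm'⟩ := hK.exists_forall_le' (a := 0)
    (f := fun p : ℝ × ℝ × ℂ × ℂ => ‖(flow (p.2.1 ^ 3 - p.2.1) p.1 (0, p.2.2)).1‖ +
      ‖(flow (p.2.1 ^ 3 - p.2.1) p.1 (0, p.2.2)).2.1 - p.2.2.1‖ + ‖p.2.2.1‖)
    (by
      refine Continuous.continuousOn ?_
      exact (hflow.fst.norm.add (hflow.snd.fst.sub (by fun_prop)).norm).add (by fun_prop))
    (by
      rintro ⟨L, ξ, v⟩ ⟨hL, ⟨-, hξ⟩, hv⟩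
      by_contra hneg
      have n1 := norm_nonneg (flow (ξ ^ 3 - ξ) L (0, v)).1
      have n2 := norm_nonneg ((flow (ξ ^ 3 - ξ) L (0, v)).2.1 - v.1)
      have n3 := norm_nonneg v.1
      simp only [not_lt] at hneg
      have z3 : v.1 = 0 := norm_eq_zero.1 (by linarith)
      have z1 : (flow (ξ ^ 3 - ξ) L (0, v)).1 = 0 := norm_eq_zero.1 (by linarith)
      have z2 : (flow (ξ ^ 3 - ξ) L (0, v)).2.1 = 0 := by
        have : (flow (ξ ^ 3 - ξ) L (0, v)).2.1 - v.1 = 0 := norm_eq_zero.1 (by linarith)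
        rwa [z3, sub_zero] at this
      have hz := (isSolution_flow L (ξ ^ 3 - ξ) (0, v)).eq_zero_of_overdetermined
        (ha.trans_le hL.1) hξ (by simp [flow_zero]) z1 (by simp [flow_zero, z3]) z2
      simp only [flow_zero] at hz
      have : v = 0 := Prod.ext z3 hz
      simp [this] at hv)
  refine ⟨m, hm, fun L hL ξ hξ hR v => ?_⟩
  rcases eq_or_ne v 0 with rfl | hv
  · have : flow (ξ ^ 3 - ξ) L (0, (0 : ℂ × ℂ)) = 0 := map_zero (NormedSpace.exp (L • system _))
    simp [this]
  · have hpos : 0 < ‖v‖ := norm_pos_iff.2 hv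
    have key := hm' (L, ξ, ‖v‖⁻¹ • v) ⟨hL, ⟨abs_le.1 hR, hξ⟩, by simp [norm_smul, hpos.ne']⟩
    have e : ((0 : ℂ), ‖v‖⁻¹ • v) = ‖v‖⁻¹ • ((0 : ℂ), v) := by simp
    simp only [e, flow_smul, Prod.smul_fst, Prod.smul_snd, ← smul_sub, norm_smul, norm_inv,
      norm_norm, ← mul_add] at key
    rwa [inv_mul_eq_div, le_div_iff₀ hpos] at key

/-- Outside the elliptic regime, `lam = ξ³ - ξ` for a root `ξ` beyond both critical points of
the cubic. -/
lemma exists_root_of_not_isElliptic {lam K : ℝ} (h : ¬ IsElliptic lam) (hK : |lam| ≤ K) :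
    ∃ ξ : ℝ, lam = ξ ^ 3 - ξ ∧ 4 ≤ 3 * ξ ^ 2 ∧ |ξ| ≤ 3 * K := by
  obtain ⟨ξ, h1, h2⟩ : ∃ ξ : ℝ, lam = ξ ^ 3 - ξ ∧ 4 ≤ 3 * ξ ^ 2 := by
    obtain ⟨ξ, -, hξ⟩ : ∃ ξ ∈ Icc (-(|lam| + 2)) (|lam| + 2), ξ ^ 3 - ξ = lam := by
      have hn := abs_nonneg lam
      have hc : ContinuousOn (fun ξ : ℝ => ξ ^ 3 - ξ) (Icc (-(|lam| + 2)) (|lam| + 2)) := by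
        fun_prop
      refine intermediate_value_Icc (by linarith) hc ⟨?_, ?_⟩
      · nlinarith [neg_abs_le lam, pow_nonneg hn 2, pow_nonneg hn 3]
      · nlinarith [le_abs_self lam, pow_nonneg hn 2, pow_nonneg hn 3]
    by_cases hlt : 4 ≤ 3 * ξ ^ 2
    · exact ⟨ξ, hξ.symm, hlt⟩
    -- a root `ξ` with `3ξ² < 4` must be double, and then `-2ξ` is the remaining root
    have hsq : 3 * ξ ^ 2 = 1 := by
      by_contra hne
      have h3 : Real.sqrt 3 ^ 2 = 3 := Real.sq_sqrt (by norm_num)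
      refine h ⟨ξ / 2, by rw [← hξ]; ring, by linarith, fun he => hne ?_, fun he => hne ?_⟩
      · have : ξ = Real.sqrt 3 / 3 := by linarith
        rw [this]; linarith
      · have : ξ = -(Real.sqrt 3 / 3) := by linarith
        rw [this]; linarith
    exact ⟨-2 * ξ, by rw [← hξ]; linear_combination (3 * ξ) * hsq, by linarith⟩
  refine ⟨ξ, h1, h2, ?_⟩
  have : |lam| = |ξ| * (ξ ^ 2 - 1) := by
    rw [h1, show ξ ^ 3 - ξ = ξ * (ξ ^ 2 - 1) by ring, abs_mul,
      abs_of_nonneg (a := ξ ^ 2 - 1) (by linarith)]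
  nlinarith [abs_nonneg ξ]

end KdV

theorem proposition4p5 (L₀ δ : ℝ) (hI : KdV.IsAdmissible L₀ δ)
    (K : ℝ) (hK : 2 * Real.sqrt 3 / 9 < K) :
    ∃ γ : ℝ, 0 < γ ∧
      ∀ L ∈ Set.Icc (L₀ - δ) (L₀ + δ), ∀ (lam : ℝ) (E : ℝ → ℂ),
        KdV.IsNormalizedEigenfunctionB L lam E → |lam| ≤ K → ¬ KdV.IsElliptic lam →
          ‖derivWithin E (Set.Icc 0 L) 0‖ = ‖derivWithin E (Set.Icc 0 L) L‖ ∧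
            γ ≤ ‖derivWithin E (Set.Icc 0 L) L‖ := by
  have hpos : 0 < L₀ - δ := by linarith [hI.radius_pos, hI.radius_lt]
  obtain ⟨m, hm, hlow⟩ := KdV.exists_lower_bound hpos (L₀ + δ) (3 * K)
  obtain ⟨M, hM⟩ := ((isCompact_Icc (a := 0) (b := L₀ + δ)).prod
    (isCompact_Icc (a := -K) (b := K))).exists_bound_of_continuousOn
      KdV.continuous_exp_system.continuousOn
  set p : ℝ := (2 : ℝ≥0∞).toReal⁻¹ with hp
  have hp0 : 0 ≤ p := by positivity
  set C : ℝ := (L₀ + δ) ^ p * M with hC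
  refine ⟨m / (|C| + 1), by positivity, fun L hL lam E hE hlam hell =>
    ⟨by rw [hE.1.1.deriv_eq], ?_⟩⟩
  have hL0 : 0 < L := hpos.trans_le hL.1
  obtain ⟨ξ, rfl, hξ, hξK⟩ := KdV.exists_root_of_not_isElliptic hell hlam
  obtain ⟨e₀, e₁, e₂, heE, he⟩ := hE.1.exists_classical hL0
  have h0 : (0 : ℝ) ∈ Icc 0 L := left_mem_Icc.2 hL0.le
  have hL' : L ∈ Icc 0 L := right_mem_Icc.2 hL0.le
  have hderiv : ∀ x ∈ Icc 0 L, derivWithin E (Icc 0 L) x = e₁ x := fun x hx =>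
    ((he x hx).1.hasDerivWithinAt.congr (fun y hy => (heE hy).symm) (heE hx).symm).derivWithin
      (uniqueDiffOn_Icc hL0 x hx)
  have b0 : e₀ 0 = 0 := (heE h0).trans hE.1.1.left
  have bL : e₀ L = 0 := (heE hL').trans hE.1.1.right
  have b1 : e₁ 0 = e₁ L := by rw [← hderiv 0 h0, ← hderiv L hL', hE.1.1.deriv_eq]
  have hflow : ∀ x ∈ Icc 0 L, (e₀ x, e₁ x, e₂ x) = KdV.flow (ξ ^ 3 - ξ) x (0, e₁ 0, e₂ 0) :=
    fun x hx => by rw [he.eq_flow hx, b0]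
  set ρ : ℝ := ‖(e₁ 0, e₂ 0)‖ with hρ
  have key := hlow L hL ξ hξ hξK (e₁ 0, e₂ 0)
  rw [← hflow L hL'] at key
  simp only [bL, b1, norm_zero, sub_self, zero_add] at key
  rw [← b1, ← hρ] at key
  rw [hderiv L hL', ← b1]
  -- the normalization bounds the Cauchy data at `0` from below
  have hbound : ∀ x ∈ Icc 0 L, ‖E x‖ ≤ M * ρ := by
    intro x hx
    rw [← heE hx]
    calc ‖e₀ x‖ ≤ ‖(e₀ x, e₁ x, e₂ x)‖ := norm_fst_le (e₀ x, e₁ x, e₂ x)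
      _ ≤ M * ‖((0 : ℂ), e₁ 0, e₂ 0)‖ := by
          rw [hflow x hx]
          exact ContinuousLinearMap.le_of_opNorm_le _
            (hM (x, ξ ^ 3 - ξ) ⟨⟨hx.1, hx.2.trans hL.2⟩, abs_le.1 hlam⟩) _
      _ = M * ρ := by rw [Prod.norm_mk (0 : ℂ), norm_zero, max_eq_right (norm_nonneg _)]
  have hMρ : 0 ≤ M * ρ := (norm_nonneg _).trans (hbound 0 h0)
  have hnorm : 1 ≤ L ^ p * (M * ρ) := by
    have := eLpNorm_le_of_ae_bound (p := 2) ((ae_restrict_iff' measurableSet_Ioo).2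
      (.of_forall fun x hx => hbound x (Ioo_subset_Icc_self hx)) :
        ∀ᵐ x ∂(volume.restrict (Ioo 0 L)), ‖E x‖ ≤ M * ρ)
    rwa [hE.2, Measure.restrict_apply_univ, Real.volume_Ioo, sub_zero, ← hp,
      ENNReal.ofReal_rpow_of_nonneg hL0.le hp0, ← ENNReal.ofReal_mul (by positivity),
      ENNReal.one_le_ofReal] at this
  have hCρ : 1 ≤ (|C| + 1) * ρ := by
    have h1 : L ^ p * (M * ρ) ≤ C * ρ := by
      rw [hC, mul_assoc]
      exact mul_le_mul_of_nonneg_right (Real.rpow_le_rpow hL0.le hL.2 hp0) hMρ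
    nlinarith [le_abs_self C, norm_nonneg (e₁ 0, e₂ 0)]
  rw [div_le_iff₀ (by positivity)]
  calc m ≤ m * ((|C| + 1) * ρ) := le_mul_of_one_le_right hm.le hCρ
    _ = m * ρ * (|C| + 1) := by ring
    _ ≤ ‖e₁ 0‖ * (|C| + 1) := by gcongr
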